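/- Setting. Let $\Theta=T_1\times\cdots\times T_k$ with $T_i\subseteq\mathbb R$ open and non-empty, and let $\{f(\cdot\mid\theta):\theta\in\Theta\}$ be a regular family of probability densities with respect to a measure $\mu$: the set $\{f(\cdot\mid\theta)>0\}$ does not depend on $\theta$, $f(x\mid\theta)$ is differentiable in $\theta$, $\int f(x\mid\theta)\,d\mu(x)$ may be differentiated under the integral sign, the score $\nabla_\theta\log f(X_1\mid\theta)$ is square integrable under $\theta$, and the Fisher information matrix $\mathbf I(\theta)=E_\theta[\nabla\log f(X_1\mid\theta)\,\nabla\log f(X_1\mid\theta)^{\top}]$ is positive definite and continuous on $\Theta$. Let $X_1,X_2,\dots$ be i.i.d. with density $f(\cdot\mid\theta)$, and let $N\ge 1$ be a proper stopping time: $\{N\le n\}$ is determined by $X_1,\dots,X_n$, and $N<\infty$ almost surely for every $\theta\in\Theta$. Let $\mathbf I^*(\theta)$ be the Fisher information matrix of the sequential experiment, i.e. the matrix of second moments under $\theta$ of the score of the likelihood $\prod_{i=1}^N f(X_i\mid\theta)$. One-at-a-time reference priors. Let $T_i^1\subseteq T_i^2\subseteq\cdots$ be compact sets with union $T_i$, and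 $\Theta^l=T^l_1\times\cdots\times T^l_k$. For an information matrix $\mathbf J(\theta)$, let $h_j(\theta)$ be the lower right entry of the inverse of the upper left $j\times j$ block of $\mathbf J(\theta)^{-1}$. Put $\pi^l_{k+1}=1$ and, for $j=k,k-1,\dots,1$, $$\pi^l_j(\theta_j,\dots,\theta_k\mid\theta_1,\dots,\theta_{j-1})=\pi^l_{j+1}(\theta_{j+1},\dots,\theta_k\mid\theta_1,\dots,\theta_j)\,\frac{\exp\{\tfrac12E^l_j[\log h_j(\theta)\mid\theta_1,\dots,\theta_j]\}\,1_{T^l_j}(\theta_j)}{\int_{T^l_j}\exp\{\tfrac12E^l_j[\log h_j(\theta)\mid\theta_1,\dots,\theta_{j-1},t]\}\,dt},$$ where $E^l_j[\,\cdot\mid\theta_1,\dots,\theta_j]$ is the expectation with respect to the density $\pi^l_{j+1}(\cdot\mid\theta_1,\dots,\theta_j)$ of $(\theta_{j+1},\dots,\theta_k)$ (for $j=k$ it is $\log h_k(\theta)$ itself). A function $\pi$ on $\Theta$ is a one-at-a-time reference prior for $\mathbf J$ (with the ordering $\theta_1,\dots,\theta_k$) if, for some $\theta^0\in\Theta$ with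 $\pi^l_1(\theta^0)>0$ for all large $l$ and some constant $c>0$, $\lim_{l\to\infty}\pi^l_1(\theta)/\pi^l_1(\theta^0)=c\,\pi(\theta)$ for all $\theta\in\Theta$. Corollary 2.1. Suppose that there are functions $G_{li},g_i:\mathbb R\to\mathbb R$ ($1\le l,i\le k$) such that, for all $\theta\in\Theta$, $$\mathbf I(\theta)=\operatorname{diag}\Big(\prod_{i=1}^kG_{1i}(\theta_i),\dots,\prod_{i=1}^kG_{ki}(\theta_i)\Big),\qquad E_\theta(N)=\prod_{i=1}^kg_i(\theta_i)<\infty,$$ and that $E_\theta(N)$ is a measurable function of $\theta\in\Theta$ that is bounded on compact subsets of $\Theta$. Then $\prod_{i=1}^k|G_{ii}(\theta_i)|^{1/2}$ is a one-at-a-time reference prior for $\mathbf I$, i.e. for the experiment that consists of the single observation $X_1$. Moreover, for every one-at-a-time reference prior $\pi_R$ for $\mathbf I$, a function $\pi_R^*$ is a one-at-a-time reference prior for $\mathbf I^*$, i.e. for the sequential experiment, if and only if $$\pi_R^*(\theta)\propto\sqrt{E_\theta(N)}\;\pi_R(\theta_1,\dots,\theta_k)\qquad\text{on }\Theta,$$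 where $\propto$ means equality up to a positive constant factor. -/

import Mathlib

open MeasureTheory ProbabilityTheory Filter Topology
open scoped ENNReal

namespace SequentialPrior

noncomputable section

/-! ## Likelihoods, scores and Fisher information -/

/-- The `a`-th coordinate of the score, i.e. the partial derivative in `θ a` of the log-likelihood
`log L(θ; ω)`. -/
def score {k : ℕ} {Ω : Type*} (L : (Fin k → ℝ) → Ω → ℝ) (θ : Fin k → ℝ) (a : Fin k) (ω : Ω) : ℝ :=
  lineDeriv ℝ (fun θ' => Real.log (L θ' ω)) θ (Pi.single a 1)

/-- The Fisher information matrix at `θ` of an experiment with laws `P θ` and likelihood `L`: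
the matrix of second moments of the score under `P θ`. -/
def fisherInfo {k : ℕ} {Ω : Type*} [MeasurableSpace Ω] (P : (Fin k → ℝ) → Measure Ω)
    (L : (Fin k → ℝ) → Ω → ℝ) (θ : Fin k → ℝ) : Matrix (Fin k) (Fin k) ℝ :=
  Matrix.of fun a b => ∫ ω, score L θ a ω * score L θ b ω ∂(P θ)

/-- The law of one observation: the distribution with density `f(· | θ)` with respect to `μ`. -/
def obsLaw {k : ℕ} {𝒳 : Type*} [MeasurableSpace 𝒳] (μ : Measure 𝒳) (f : (Fin k → ℝ) → 𝒳 → ℝ)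
    (θ : Fin k → ℝ) : Measure 𝒳 :=
  μ.withDensity fun x => ENNReal.ofReal (f θ x)

/-- The Fisher information matrix `I(θ)` of a single observation. -/
def obsInfo {k : ℕ} {𝒳 : Type*} [MeasurableSpace 𝒳] (μ : Measure 𝒳) (f : (Fin k → ℝ) → 𝒳 → ℝ)
    (θ : Fin k → ℝ) : Matrix (Fin k) (Fin k) ℝ :=
  fisherInfo (obsLaw μ f) f θ

/-- A regular family of densities `f(· | θ)`, `θ ∈ Θ`, with respect to `μ`: the usual regularity
conditions under which the Fisher information is well behaved. -/
structure IsRegularFamily {k : ℕ} {𝒳 : Type*} [MeasurableSpace 𝒳] (μ : Measure 𝒳)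
    (Θ : Set (Fin k → ℝ)) (f : (Fin k → ℝ) → 𝒳 → ℝ) : Prop where
  measurable : ∀ θ ∈ Θ, Measurable (f θ)
  /-- the set where the density is positive does not depend on the parameter -/
  common_support : ∀ x, (∀ θ ∈ Θ, 0 < f θ x) ∨ (∀ θ ∈ Θ, f θ x = 0)
  isProbability : ∀ θ ∈ Θ, IsProbabilityMeasure (obsLaw μ f θ)
  differentiable : ∀ x, DifferentiableOn ℝ (fun θ => f θ x) Θ
  /-- `∫ f(x | θ) dμ(x)` may be differentiated under the integral sign -/
  integral_deriv : ∀ θ ∈ Θ, ∀ a : Fin k,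
    ∫ x, lineDeriv ℝ (fun θ' => f θ' x) θ (Pi.single a 1) ∂μ =
      lineDeriv ℝ (fun θ' => ∫ x, f θ' x ∂μ) θ (Pi.single a 1)
  score_memLp : ∀ θ ∈ Θ, ∀ a : Fin k, MemLp (score f θ a) 2 (obsLaw μ f θ)
  info_posDef : ∀ θ ∈ Θ, (obsInfo μ f θ).PosDef
  info_continuous : ContinuousOn (obsInfo μ f) Θ

/-! ## The sequential experiment -/

/-- The information available after `n` observations; the observations are
`X 0, X 1, X 2, …`, and the `n`-th sigma-algebra is generated by the first `n` of them. -/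
def obsFiltration {Ω 𝒳 : Type*} [mΩ : MeasurableSpace Ω] [MeasurableSpace 𝒳]
    (X : ℕ → Ω → 𝒳) (hX : ∀ i, Measurable (X i)) : Filtration ℕ mΩ where
  seq n := ⨆ (i : ℕ) (_ : i < n), MeasurableSpace.comap (X i) inferInstance
  mono' _ _ h := iSup₂_le fun i hi =>
    le_iSup₂_of_le (f := fun (i : ℕ) (_ : i < _) => MeasurableSpace.comap (X i) inferInstance)
      i (lt_of_lt_of_le hi h) le_rfl
  le' _ := iSup₂_le fun i _ => (hX i).comap_le

/-- `X 0, X 1, …` is, for each `θ ∈ Θ`, an i.i.d. sequence under `P θ` with density `f(· | θ)`. -/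
structure IsIIDSample {k : ℕ} {Ω 𝒳 : Type*} [MeasurableSpace Ω] [MeasurableSpace 𝒳]
    (μ : Measure 𝒳) (Θ : Set (Fin k → ℝ)) (f : (Fin k → ℝ) → 𝒳 → ℝ)
    (P : (Fin k → ℝ) → Measure Ω) (X : ℕ → Ω → 𝒳) : Prop where
  indep : ∀ θ ∈ Θ, iIndepFun X (P θ)
  law : ∀ θ ∈ Θ, ∀ i, (P θ).map (X i) = obsLaw μ f θ

/-- `N` (the total number of observations taken) is a proper stopping time: at least one
observation is taken, whether to stop after `n` observations is decided by these `n` observations,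
and sampling stops almost surely, for every parameter value. -/
structure IsProperStoppingTime {k : ℕ} {Ω 𝒳 : Type*} [MeasurableSpace Ω] [MeasurableSpace 𝒳]
    (Θ : Set (Fin k → ℝ)) (P : (Fin k → ℝ) → Measure Ω)
    (X : ℕ → Ω → 𝒳) (hX : ∀ i, Measurable (X i)) (N : Ω → ℕ∞) : Prop where
  isStoppingTime : IsStoppingTime (obsFiltration X hX) N
  one_le : ∀ ω, 1 ≤ N ω
  finite : ∀ θ ∈ Θ, ∀ᵐ ω ∂(P θ), N ω ≠ ⊤

/-- The expected stopping time `E_θ(N)`, possibly infinite. -/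
def expectedN {k : ℕ} {Ω : Type*} [MeasurableSpace Ω] (P : (Fin k → ℝ) → Measure Ω) (N : Ω → ℕ∞)
    (θ : Fin k → ℝ) : ℝ≥0∞ :=
  ∫⁻ ω, (N ω : ℝ≥0∞) ∂(P θ)

/-- The likelihood `∏_{i ≤ N} f(X_i | θ)` of the data `(X_1, …, X_N)` of the sequential experiment.
(On the null event `N = ∞` the value is irrelevant.) -/
def stoppedLikelihood {k : ℕ} {Ω 𝒳 : Type*} (f : (Fin k → ℝ) → 𝒳 → ℝ) (X : ℕ → Ω → 𝒳)
    (N : Ω → ℕ∞) (θ : Fin k → ℝ) (ω : Ω) : ℝ :=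
  ∏ i ∈ Finset.range (N ω).toNat, f θ (X i ω)

/-- The Fisher information matrix `I*(θ)` of the sequential experiment, i.e. of the data
`(X_1, …, X_N)`. -/
def sequentialInfo {k : ℕ} {Ω 𝒳 : Type*} [MeasurableSpace Ω] (f : (Fin k → ℝ) → 𝒳 → ℝ)
    (P : (Fin k → ℝ) → Measure Ω) (X : ℕ → Ω → 𝒳) (N : Ω → ℕ∞)
    (θ : Fin k → ℝ) : Matrix (Fin k) (Fin k) ℝ :=
  fisherInfo P (stoppedLikelihood f X N) θ

/-! ## One-at-a-time reference priors (the Berger-Bernardo algorithm)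

The parameters are ordered as `θ 0, θ 1, …, θ (k-1)`, and every group consists of one parameter. -/

/-- For an information matrix `I` with inverse `S = I⁻¹`, let `S_j` be the upper left block of `S`
that belongs to the parameters up to and including `j`, and `H_j = S_j⁻¹`. Then `h_j` is the lower
right entry of `H_j`. -/
def condInfo {k : ℕ} (I : Matrix (Fin k) (Fin k) ℝ) (j : Fin k) : ℝ :=
  ((I⁻¹).submatrix (Subtype.val : {i : Fin k // i ≤ j} → Fin k)
    (Subtype.val : {i : Fin k // i ≤ j} → Fin k))⁻¹ ⟨j, le_rfl⟩ ⟨j, le_rfl⟩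

/-- The values that the `j`-th parameter can take in `A`, given the values `θ i` for `i < j`. -/
def condSection {k : ℕ} (A : Set (Fin k → ℝ)) (j : Fin k) (θ : Fin k → ℝ) : Set ℝ :=
  {t | ∃ θ' ∈ A, (∀ i < j, θ' i = θ i) ∧ θ' j = t}

/-- Given a conditional density `p` of the parameters after `j` given those up to `j`, this is
`exp (½ E[log h_j | θ_0, …, θ_j])`, the expectation being taken with respect to `p`. -/
def expHalfMeanLog {k : ℕ} (I : (Fin k → ℝ) → Matrix (Fin k) (Fin k) ℝ) (j : Fin k)
    (p : (Fin k → ℝ) → ℝ) (θ : Fin k → ℝ) : ℝ :=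
  Real.exp ((1 / 2) * ∫ u : (Finset.Ioi j → ℝ),
    Real.log (condInfo (I (Function.updateFinset θ (Finset.Ioi j) u)) j) *
      p (Function.updateFinset θ (Finset.Ioi j) u))

open scoped Classical in
/-- `condPrior I A r` is the conditional reference prior density on `A` of the last `r` parameters
given the first `k - r` ones. The step from `r` to `r + 1` includes the parameter
`j = k - 1 - r`: the density is multiplied by the normalized restriction to `A` of
`exp (½ E[log h_j | θ_0, …, θ_j])`. For `r = 0` the integral in the expectation is the value of
`log h_j` itself, so that the first step yields the normalized restriction of `h_{k-1}^{1/2}`. -/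
def condPrior {k : ℕ} (I : (Fin k → ℝ) → Matrix (Fin k) (Fin k) ℝ) (A : Set (Fin k → ℝ)) :
    ℕ → (Fin k → ℝ) → ℝ
  | 0 => fun _ => 1
  | r + 1 => fun θ =>
      if h : r < k then
        let j : Fin k := Fin.rev ⟨r, h⟩
        condPrior I A r θ *
          ((if θ j ∈ condSection A j θ then expHalfMeanLog I j (condPrior I A r) θ else 0) /
            ∫ t in condSection A j θ,
              expHalfMeanLog I j (condPrior I A r) (Function.update θ j t))
      else condPrior I A r θ

/-- The one-at-a-time reference prior density on the (compact) set `A`. -/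
def priorOn {k : ℕ} (I : (Fin k → ℝ) → Matrix (Fin k) (Fin k) ℝ) (A : Set (Fin k → ℝ)) :
    (Fin k → ℝ) → ℝ :=
  condPrior I A k

/-- `π` is (a version of) the one-at-a-time reference prior on `Θ` for the information matrix `I`
and the sets `A 0 ⊆ A 1 ⊆ …`: up to a positive constant factor, `π θ` is the limit of
`π^l θ / π^l θ₀` as `l → ∞`, where `π^l` is the reference prior density on `A l`, and `θ₀ ∈ Θ` is
some fixed point. -/
def IsReferencePrior {k : ℕ} (Θ : Set (Fin k → ℝ)) (I : (Fin k → ℝ) → Matrix (Fin k) (Fin k) ℝ)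
    (A : ℕ → Set (Fin k → ℝ)) (π : (Fin k → ℝ) → ℝ) : Prop :=
  ∃ θ₀ ∈ Θ, (∀ᶠ l in atTop, 0 < priorOn I (A l) θ₀) ∧
    ∃ c : ℝ, 0 < c ∧
      ∀ θ ∈ Θ, Tendsto (fun l => priorOn I (A l) θ / priorOn I (A l) θ₀) atTop (𝓝 (c * π θ))

/-- The sets `K 0 i ⊆ K 1 i ⊆ …` are compact with union `T i`, for each `i`, so that the boxes
`∏ i, K l i` are an increasing sequence of compact sets with union `∏ i, T i`. -/
structure IsCompactExhaustion {k : ℕ} (T : Fin k → Set ℝ) (K : ℕ → Fin k → Set ℝ) : Prop where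
  isCompact : ∀ l i, IsCompact (K l i)
  mono : ∀ i, Monotone fun l => K l i
  iUnion_eq : ∀ i, ⋃ l, K l i = T i

/-- Two functions are proportional on `Θ`, with a positive constant. -/
def ProportionalOn {k : ℕ} (Θ : Set (Fin k → ℝ)) (π₁ π₂ : (Fin k → ℝ) → ℝ) : Prop :=
  ∃ c : ℝ, 0 < c ∧ ∀ θ ∈ Θ, π₁ θ = c * π₂ θ

end

end SequentialPrior

open SequentialPrior

namespace SequentialPrior

/-! ## Information matrices of product form on a box -/

/-! For a diagonal information matrix, `h_j` is just the `j`-th diagonal entry, so in the product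
case `log h_j` is the sum of the `log |G j i (θ i)|`. Given the coordinates up to `j`, the later
ones have, by induction, a product density that does not involve the earlier ones. In the
conditional expectation only the term `i = j` therefore depends on `θ j`; the others form a factor
that cancels in the normalization. Hence the prior on a box is the product of the densities
proportional to `√|G i i|` (`IsProductInfoOn.priorOn_eq`), and the quotient of its values at two
points does not change once the box contains both. So the reference priors are exactly the positive
multiples of `∏ i, √|G i i (θ i)|` (`isReferencePrior_iff`).

The score of the stopped likelihood is a randomly stopped sum of centred i.i.d. scores. Wald's
second identity (`integral_stoppedSum_mul`) gives `I* = E(N) • I` (`sequentialInfo_eq`). Thus `I*`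
is again of product form, with `g i * G l i` in place of `G l i`, and the criterion applied to both
matrices produces the factor `√E(N)`.

Only the products of the `G l i`, or of the `g i`, are known to be positive, measurable and locally
bounded; single factors may be negative. This accounts for the absolute values and for the detours
through whole products. -/

theorem inv_diagonal_of_ne_zero {n : Type*} [Fintype n] [DecidableEq n] {d : n → ℝ}
    (hd : ∀ i, d i ≠ 0) : (Matrix.diagonal d)⁻¹ = Matrix.diagonal fun i => (d i)⁻¹ := by
  apply Matrix.inv_eq_right_inv
  rw [Matrix.diagonal_mul_diagonal, ← Matrix.diagonal_one]
  congr 1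
  funext i
  exact mul_inv_cancel₀ (hd i)

theorem condInfo_diagonal {k : ℕ} {d : Fin k → ℝ} (hd : ∀ i, d i ≠ 0) (j : Fin k) :
    condInfo (Matrix.diagonal d) j = d j := by
  rw [condInfo, inv_diagonal_of_ne_zero hd,
    Matrix.submatrix_diagonal _ _ Subtype.val_injective, inv_diagonal_of_ne_zero]
  · simp
  · exact fun i => inv_ne_zero (hd _)

theorem condSection_pi {k : ℕ} {B : Fin k → Set ℝ} (hB : ∀ i, (B i).Nonempty) {j : Fin k}
    {θ : Fin k → ℝ} (hθ : ∀ i < j, θ i ∈ B i) : condSection (Set.univ.pi B) j θ = B j := by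
  ext t
  constructor
  · rintro ⟨θ', hθ', -, rfl⟩
    exact hθ' j trivial
  · intro ht
    -- The coordinates after `j` are arbitrary points of the nonempty sides.
    refine ⟨fun i => if i < j then θ i else if i = j then t else (hB i).some, ?_, ?_, ?_⟩
    · intro i _
      dsimp only
      split_ifs with h1 h2
      · exact hθ i h1
      · exact h2 ▸ ht
      · exact (hB i).some_mem
    · intro i hi
      simp [hi]
    · simp

/-- The probability density on `B` that is proportional to `φ`. -/
noncomputable def normalizedDensity (φ : ℝ → ℝ) (B : Set ℝ) (t : ℝ) : ℝ :=
  B.indicator φ t / ∫ s in B, φ s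

theorem integrable_normalizedDensity {φ : ℝ → ℝ} {B : Set ℝ} (hB : MeasurableSet B)
    (hφ : IntegrableOn φ B) : Integrable (normalizedDensity φ B) :=
  ((integrable_indicator_iff hB).2 hφ).div_const _

theorem integral_normalizedDensity {φ : ℝ → ℝ} {B : Set ℝ} (hB : MeasurableSet B)
    (hφ : ∫ s in B, φ s ≠ 0) : ∫ t, normalizedDensity φ B t = 1 := by
  unfold normalizedDensity
  rw [integral_div, integral_indicator hB, div_self hφ]

/-- On the box `∏ i, B i`, whose sides have positive and finite length, the information matrix `J`
is diagonal, with positive diagonal entries of product form that are measurable and bounded away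
from zero and infinity. -/
structure IsProductInfoOn {k : ℕ} (B : Fin k → Set ℝ) (J : (Fin k → ℝ) → Matrix (Fin k) (Fin k) ℝ)
    (G : Fin k → Fin k → ℝ → ℝ) : Prop where
  measurableSet : ∀ i, MeasurableSet (B i)
  volume_pos : ∀ i, 0 < volume (B i)
  volume_lt_top : ∀ i, volume (B i) < ⊤
  eq_diagonal : ∀ θ ∈ Set.univ.pi B, J θ = Matrix.diagonal fun l => ∏ i, G l i (θ i)
  pos : ∀ θ ∈ Set.univ.pi B, ∀ l, 0 < ∏ i, G l i (θ i)
  measurable : ∀ l, Measurable ((Set.univ.pi B).indicator fun θ => ∏ i, G l i (θ i))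
  log_bdd : ∀ l, ∃ M, ∀ θ ∈ Set.univ.pi B, |Real.log (∏ i, G l i (θ i))| ≤ M

namespace IsProductInfoOn

variable {k : ℕ} {B : Fin k → Set ℝ} {J : (Fin k → ℝ) → Matrix (Fin k) (Fin k) ℝ}
  {G : Fin k → Fin k → ℝ → ℝ}

theorem nonempty (h : IsProductInfoOn B J G) (i : Fin k) : (B i).Nonempty :=
  nonempty_of_measure_ne_zero (h.volume_pos i).ne'

theorem apply_ne_zero (h : IsProductInfoOn B J G) (l i : Fin k) {t : ℝ} (ht : t ∈ B i) :
    G l i t ≠ 0 := by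
  classical
  have hmem : Function.update (fun m => (h.nonempty m).some) i t ∈ Set.univ.pi B := by
    intro m _
    by_cases hm : m = i
    · subst hm
      simpa using ht
    · simpa [hm] using (h.nonempty m).some_mem
  have := Finset.prod_ne_zero_iff.1 (h.pos _ hmem l).ne' i (Finset.mem_univ i)
  simpa using this

/-- Freezing all coordinates but the `j`-th turns the product of the `j`-th row into a constant
times `|G j j|`, which thereby inherits measurability and boundedness on `B j`. -/
theorem integrableOn_sqrt (h : IsProductInfoOn B J G) (j : Fin k) :
    IntegrableOn (fun t => √|G j j t|) (B j) := by
  classical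
  set θ₀ : Fin k → ℝ := fun m => (h.nonempty m).some with hθ₀
  have hmem : ∀ t, Function.update θ₀ j t ∈ Set.univ.pi B ↔ t ∈ B j := by
    intro t
    constructor
    · intro H
      simpa using H j trivial
    · intro ht m _
      by_cases hm : m = j
      · subst hm
        simpa using ht
      · simpa [hm] using (h.nonempty m).some_mem
  set c : ℝ := ∏ i ∈ Finset.univ.erase j, |G j i (θ₀ i)| with hc
  have hcpos : 0 < c := Finset.prod_pos fun i _ =>
    abs_pos.2 (h.apply_ne_zero j i (h.nonempty i).some_mem)
  have hprod : ∀ t ∈ B j, ∏ i, G j i (Function.update θ₀ j t i) = |G j j t| * c := by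
    intro t ht
    rw [← abs_of_pos (h.pos _ ((hmem t).2 ht) j), Finset.abs_prod,
      ← Finset.mul_prod_erase _ _ (Finset.mem_univ j)]
    congr 1
    · simp
    · refine Finset.prod_congr rfl fun i hi => ?_
      rw [Function.update_of_ne (Finset.ne_of_mem_erase hi)]
  have hind : (B j).indicator (fun t => √|G j j t|) = fun t =>
      √((Set.univ.pi B).indicator (fun θ => ∏ i, G j i (θ i)) (Function.update θ₀ j t) / c) := by
    funext t
    by_cases ht : t ∈ B j
    · rw [Set.indicator_of_mem ht, Set.indicator_of_mem ((hmem t).2 ht), hprod t ht,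
        mul_div_cancel_right₀ _ hcpos.ne']
    · rw [Set.indicator_of_notMem ht, Set.indicator_of_notMem fun H => ht ((hmem t).1 H)]
      simp
  have hmeas : Measurable ((B j).indicator fun t => √|G j j t|) := by
    rw [hind]
    exact (((h.measurable j).comp (measurable_update θ₀)).div_const c).sqrt
  obtain ⟨M, hM⟩ := h.log_bdd j
  -- Measurability is known only for the indicator, so the claim is passed to the indicator and then
  -- restricted to `B j` again, where the bound holds.
  rw [← integrable_indicator_iff (h.measurableSet j), ← integrableOn_iff_integrable_of_support_subset
    (Set.support_indicator_subset)]
  refine Measure.integrableOn_of_bounded (M := √(Real.exp M / c)) (h.volume_lt_top j).ne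
    hmeas.aestronglyMeasurable ?_
  refine (ae_restrict_iff' (h.measurableSet j)).2 (ae_of_all _ fun t ht => ?_)
  rw [Set.indicator_of_mem ht, Real.norm_of_nonneg (Real.sqrt_nonneg _)]
  refine Real.sqrt_le_sqrt ?_
  rw [le_div_iff₀ hcpos, ← hprod t ht, ← Real.exp_log (h.pos _ ((hmem t).2 ht) j)]
  exact Real.exp_le_exp.2 ((le_abs_self _).trans (hM _ ((hmem t).2 ht)))

theorem integral_sqrt_pos (h : IsProductInfoOn B J G) (j : Fin k) :
    0 < ∫ t in B j, √|G j j t| := by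
  rw [setIntegral_pos_iff_support_of_nonneg_ae (ae_of_all _ fun t => Real.sqrt_nonneg _)
    (h.integrableOn_sqrt j)]
  refine (h.volume_pos j).trans_le (measure_mono fun t ht => ⟨?_, ht⟩)
  exact (Real.sqrt_pos.2 (abs_pos.2 (h.apply_ne_zero j j ht))).ne'

/-- With an expectation under a product density, `exp (½ E[log h_j | θ_0, …, θ_j])` factorizes. -/
theorem expHalfMeanLog_eq (h : IsProductInfoOn B J G) (j : Fin k) (p : (Fin k → ℝ) → ℝ)
    {θ : Fin k → ℝ} (hθ : ∀ i ≤ j, θ i ∈ B i)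
    (hp : ∀ u : (Finset.Ioi j → ℝ), p (Function.updateFinset θ (Finset.Ioi j) u) =
      ∏ i : Finset.Ioi j, normalizedDensity (fun t => √|G i i t|) (B i) (u i)) :
    expHalfMeanLog J j p θ = √|G j j (θ j)| *
      Real.exp ((1 / 2) * ∫ u : (Finset.Ioi j → ℝ),
        (∑ i ∈ Finset.univ.erase j,
          Real.log |G j i (Function.updateFinset θ (Finset.Ioi j) u i)|) *
        ∏ i : Finset.Ioi j, normalizedDensity (fun t => √|G i i t|) (B i) (u i)) := by
  classical
  set D : (Finset.Ioi j → ℝ) → ℝ :=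
    fun u => ∏ i : Finset.Ioi j, normalizedDensity (fun t => √|G i i t|) (B i) (u i) with hD
  set E : (Finset.Ioi j → ℝ) → (Fin k → ℝ) := fun u => Function.updateFinset θ (Finset.Ioi j) u
    with hE
  have hElow : ∀ u, ∀ i ≤ j, E u i = θ i := by
    intro u i hi
    simp [hE, Function.updateFinset, not_lt.2 hi]
  have hDint : Integrable D := by
    refine Integrable.fintype_prod (μ := fun _ => volume)
      (f := fun (i : Finset.Ioi j) => normalizedDensity (fun t => √|G i i t|) (B i)) fun i => ?_
    exact integrable_normalizedDensity (h.measurableSet i) (h.integrableOn_sqrt i)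
  have hDone : ∫ u, D u = 1 := by
    rw [hD, integral_fintype_prod_volume_eq_prod
      (fun (i : Finset.Ioi j) => normalizedDensity (fun t => √|G i i t|) (B i))]
    exact Finset.prod_eq_one fun i _ =>
      integral_normalizedDensity (h.measurableSet i) (h.integral_sqrt_pos i).ne'
  -- The weight `D` vanishes off the box, so nothing about `J` or `G` is needed there.
  have hout : ∀ u, E u ∉ Set.univ.pi B → D u = 0 := by
    intro u hu
    simp only [Set.mem_univ_pi, not_forall] at hu
    obtain ⟨i, hi⟩ := hu
    have hij : j < i := by
      by_contra hij
      rw [hElow u i (not_lt.1 hij)] at hi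
      exact hi (hθ i (not_lt.1 hij))
    have hmem : i ∈ Finset.Ioi j := Finset.mem_Ioi.2 hij
    refine Finset.prod_eq_zero (Finset.mem_univ (⟨i, hmem⟩ : Finset.Ioi j)) ?_
    have : E u i = u ⟨i, hmem⟩ := by simp [hE, Function.updateFinset, hij]
    rw [this] at hi
    simp [normalizedDensity, hi]
  -- Cutting off the product before taking the logarithm makes `F` measurable everywhere; off the
  -- box it is `Real.log 0 = 0`, whence the bound `max M 0` below.
  set F : (Finset.Ioi j → ℝ) → ℝ := fun u =>
    Real.log ((Set.univ.pi B).indicator (fun θ => ∏ i, G j i (θ i)) (E u)) with hF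
  obtain ⟨M, hM⟩ := h.log_bdd j
  have hFmeas : Measurable F := ((h.measurable j).comp measurable_updateFinset).log
  have hFD : Integrable fun u => F u * D u := by
    refine hDint.bdd_mul (c := max M 0) hFmeas.aestronglyMeasurable (ae_of_all _ fun u => ?_)
    by_cases hu : E u ∈ Set.univ.pi B
    · simp only [hF, Set.indicator_of_mem hu, Real.norm_eq_abs]
      exact (hM _ hu).trans (le_max_left _ _)
    · simp [hF, Set.indicator_of_notMem hu]
  have hsplit : ∀ u, F u * D u = Real.log |G j j (θ j)| * D u +
      (∑ i ∈ Finset.univ.erase j, Real.log |G j i (E u i)|) * D u := by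
    intro u
    by_cases hu : E u ∈ Set.univ.pi B
    · rw [← add_mul]
      congr 1
      simp only [hF, Set.indicator_of_mem hu]
      rw [← Real.log_abs, Finset.abs_prod, Real.log_prod, ← Finset.add_sum_erase _ _
        (Finset.mem_univ j), hElow u j le_rfl]
      exact fun i _ => abs_ne_zero.2 (h.apply_ne_zero j i (hu i trivial))
    · simp [hout u hu]
  -- The single logarithms are not known to be measurable; integrability of their weighted sum comes
  -- from a difference of integrable functions.
  have hrest : Integrable fun u =>
      (∑ i ∈ Finset.univ.erase j, Real.log |G j i (E u i)|) * D u := by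
    refine (hFD.sub (hDint.const_mul (Real.log |G j j (θ j)|))).congr (ae_of_all _ fun u => ?_)
    simp [hsplit u]
  have hmain : ∀ u, Real.log (condInfo (J (E u)) j) * p (E u) = F u * D u := by
    intro u
    rw [hp u]
    by_cases hu : E u ∈ Set.univ.pi B
    · rw [h.eq_diagonal _ hu, condInfo_diagonal fun i => (h.pos _ hu i).ne']
      simp only [hF, Set.indicator_of_mem hu, hD]
    · rw [hout u hu]
      have := hout u hu
      simp only [hD] at this
      rw [this]
      simp
  unfold expHalfMeanLog
  change Real.exp ((1 / 2) * ∫ u, Real.log (condInfo (J (E u)) j) * p (E u)) = _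
  rw [integral_congr_ae (ae_of_all _ hmain), integral_congr_ae (ae_of_all _ hsplit),
    integral_add (hDint.const_mul _) hrest, integral_const_mul, hDone, mul_one, mul_add,
    Real.exp_add]
  congr 1
  have hG : 0 < |G j j (θ j)| := abs_pos.2 (h.apply_ne_zero j j (hθ j le_rfl))
  rw [Real.sqrt_eq_rpow, Real.rpow_def_of_pos hG, mul_comm]

/-- Membership is required only of the conditioning coordinates, which determine the sections; for
the last `r` coordinates, the indicators in `normalizedDensity` do the cutting off. -/
theorem condPrior_eq (h : IsProductInfoOn B J G) {r : ℕ} (hr : r ≤ k) {θ : Fin k → ℝ}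
    (hθ : ∀ i : Fin k, (i : ℕ) + r < k → θ i ∈ B i) :
    condPrior J (Set.univ.pi B) r θ =
      ∏ i with k ≤ (i : Fin k) + r, normalizedDensity (fun t => √|G i i t|) (B i) (θ i) := by
  classical
  induction r generalizing θ with
  | zero =>
    rw [condPrior, Finset.prod_eq_one]
    intro i hi
    have := (Finset.mem_filter.1 hi).2
    omega
  | succ r ih =>
    have hrk : r < k := hr
    rw [condPrior]
    dsimp only
    rw [dif_pos hrk]
    set j : Fin k := Fin.rev ⟨r, hrk⟩ with hj
    have hjv : (j : ℕ) = k - (r + 1) := by simp [hj, Fin.val_rev]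
    have hlow : ∀ i < j, θ i ∈ B i := by
      intro i hi
      refine hθ i ?_
      have : (i : ℕ) < j := hi
      omega
    have hfilter : (Finset.univ.filter fun i : Fin k => k ≤ (i : ℕ) + (r + 1)) =
        insert j (Finset.univ.filter fun i : Fin k => k ≤ (i : ℕ) + r) := by
      ext i
      simp only [Finset.mem_filter, Finset.mem_univ, true_and, Finset.mem_insert, Fin.ext_iff]
      omega
    have hIoi : (Finset.univ.filter fun i : Fin k => k ≤ (i : ℕ) + r) = Finset.Ioi j := by
      ext i
      simp only [Finset.mem_filter, Finset.mem_univ, true_and, Finset.mem_Ioi, Fin.lt_def]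
      omega
    have hnot : j ∉ Finset.univ.filter fun i : Fin k => k ≤ (i : ℕ) + r := by
      rw [hIoi]
      simp
    rw [condSection_pi h.nonempty hlow, hfilter, Finset.prod_insert hnot]
    -- Off `B j` both sides vanish; on it the induction hypothesis applies, since it treats `θ j` as
    -- a conditioning coordinate.
    by_cases hjB : θ j ∈ B j
    swap
    · simp [hjB, normalizedDensity]
    rw [if_pos hjB, ih hrk.le, mul_comm]
    swap
    · intro i hi
      rcases lt_or_eq_of_le (show i ≤ j by rw [Fin.le_def]; omega) with hij | hij
      · exact hlow i hij
      · exact hij ▸ hjB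
    congr 1
    -- The exponential involves `θ` and not `Function.update θ j t`, because its sum omits `i = j`.
    -- Being free of `t`, it cancels against the normalizing integral.
    have hfac : ∀ t ∈ B j, expHalfMeanLog J j (condPrior J (Set.univ.pi B) r)
        (Function.update θ j t) = √|G j j t| *
      Real.exp ((1 / 2) * ∫ u : (Finset.Ioi j → ℝ),
        (∑ i ∈ Finset.univ.erase j,
          Real.log |G j i (Function.updateFinset θ (Finset.Ioi j) u i)|) *
        ∏ i : Finset.Ioi j, normalizedDensity (fun t => √|G i i t|) (B i) (u i)) := by
      intro t ht
      have hup : ∀ i ≤ j, Function.update θ j t i ∈ B i := by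
        intro i hi
        rcases lt_or_eq_of_le hi with hij | hij
        · rw [Function.update_of_ne hij.ne]
          exact hlow i hij
        · subst hij
          simpa using ht
      rw [h.expHalfMeanLog_eq j _ hup, Function.update_self]
      · congr 4
        funext u
        congr 1
        refine Finset.sum_congr rfl fun i hi => ?_
        have hij := Finset.ne_of_mem_erase hi
        simp [Function.updateFinset, Function.update_of_ne hij]
      · intro u
        rw [ih hrk.le, hIoi, ← Finset.prod_coe_sort]
        · refine Finset.prod_congr rfl fun i _ => ?_
          simp [Function.updateFinset]
        · intro i hi
          have hij : i ≤ j := by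
            rw [Fin.le_def]
            omega
          have : Function.updateFinset (Function.update θ j t) (Finset.Ioi j) u i =
              Function.update θ j t i := by
            simp [Function.updateFinset, not_lt.2 hij]
          rw [this]
          exact hup i hij
    have hself := hfac (θ j) hjB
    rw [Function.update_eq_self] at hself
    rw [hself, setIntegral_congr_fun (h.measurableSet j) hfac, integral_mul_const,
      mul_div_mul_right _ _ (Real.exp_pos _).ne', normalizedDensity, Set.indicator_of_mem hjB]

theorem priorOn_eq (h : IsProductInfoOn B J G) (θ : Fin k → ℝ) :
    priorOn J (Set.univ.pi B) θ = ∏ i, normalizedDensity (fun t => √|G i i t|) (B i) (θ i) := by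
  rw [priorOn, h.condPrior_eq le_rfl fun i hi => absurd hi (by omega)]
  congr 1
  ext i
  simp

theorem priorOn_eq_of_mem (h : IsProductInfoOn B J G) {θ : Fin k → ℝ}
    (hθ : θ ∈ Set.univ.pi B) : priorOn J (Set.univ.pi B) θ =
      (∏ i, √|G i i (θ i)|) / ∏ i, ∫ t in B i, √|G i i t| := by
  rw [h.priorOn_eq, ← Finset.prod_div_distrib]
  refine Finset.prod_congr rfl fun i _ => ?_
  rw [normalizedDensity, Set.indicator_of_mem (hθ i trivial)]

end IsProductInfoOn

/-! ## Reference priors for information matrices of product form -/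

theorem IsCompactExhaustion.subset {k : ℕ} {T : Fin k → Set ℝ} {K : ℕ → Fin k → Set ℝ}
    (hK : IsCompactExhaustion T K) (l : ℕ) : Set.univ.pi (K l) ⊆ Set.univ.pi T :=
  Set.pi_mono fun i _ => hK.iUnion_eq i ▸ Set.subset_iUnion (fun l => K l i) l

theorem IsCompactExhaustion.eventually_mem {k : ℕ} {T : Fin k → Set ℝ} {K : ℕ → Fin k → Set ℝ}
    (hK : IsCompactExhaustion T K) {θ : Fin k → ℝ} (hθ : θ ∈ Set.univ.pi T) :
    ∀ᶠ l in atTop, θ ∈ Set.univ.pi (K l) := by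
  simp only [Set.mem_univ_pi]
  refine eventually_all.2 fun i => ?_
  have : θ i ∈ ⋃ l, K l i := by
    rw [hK.iUnion_eq]
    exact hθ i trivial
  obtain ⟨l, hl⟩ := Set.mem_iUnion.1 this
  exact eventually_atTop.2 ⟨l, fun m hm => hK.mono i hm hl⟩

theorem IsCompactExhaustion.eventually_volume_pos {k : ℕ} {T : Fin k → Set ℝ}
    {K : ℕ → Fin k → Set ℝ} (hK : IsCompactExhaustion T K) (hT_open : ∀ i, IsOpen (T i))
    (hT_ne : ∀ i, (T i).Nonempty) : ∀ᶠ l in atTop, ∀ i, 0 < volume (K l i) := by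
  refine eventually_all.2 fun i => ?_
  obtain ⟨l, hl⟩ : ∃ l, 0 < volume (K l i) := by
    by_contra! H
    have h0 : volume (⋃ l, K l i) = 0 := measure_iUnion_null fun l => le_antisymm (H l) bot_le
    rw [hK.iUnion_eq] at h0
    exact ((hT_open i).measure_pos volume (hT_ne i)).ne' h0
  exact eventually_atTop.2 ⟨l, fun m hm => hl.trans_le (measure_mono (hK.mono i hm))⟩

/-- If the information matrix is diagonal with entries of product form, then the one-at-a-time
reference priors are the positive multiples of `∏ i, |G i i (θ i)|^{1/2}`. -/
theorem isReferencePrior_iff {k : ℕ} {T : Fin k → Set ℝ} (hT_open : ∀ i, IsOpen (T i))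
    (hT_ne : ∀ i, (T i).Nonempty) {K : ℕ → Fin k → Set ℝ} (hK : IsCompactExhaustion T K)
    {J : (Fin k → ℝ) → Matrix (Fin k) (Fin k) ℝ} {G : Fin k → Fin k → ℝ → ℝ}
    (hJ : ∀ θ ∈ Set.univ.pi T, J θ = Matrix.diagonal fun l => ∏ i, G l i (θ i))
    (hpos : ∀ θ ∈ Set.univ.pi T, ∀ l, 0 < ∏ i, G l i (θ i))
    (hmeas : ∀ l, Measurable ((Set.univ.pi T).indicator fun θ => ∏ i, G l i (θ i)))
    (hbdd : ∀ l, ∀ C ⊆ Set.univ.pi T, IsCompact C →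
      ∃ M, ∀ θ ∈ C, |Real.log (∏ i, G l i (θ i))| ≤ M) (π : (Fin k → ℝ) → ℝ) :
    IsReferencePrior (Set.univ.pi T) J (fun l => Set.univ.pi (K l)) π ↔
      ProportionalOn (Set.univ.pi T) π fun θ => ∏ i, √|G i i (θ i)| := by
  -- The first boxes may be empty or null, so this holds only eventually.
  have hinfo : ∀ᶠ l in atTop, IsProductInfoOn (K l) J G := by
    filter_upwards [hK.eventually_volume_pos hT_open hT_ne] with l hl
    refine ⟨fun i => (hK.isCompact l i).measurableSet, hl,
      fun i => (hK.isCompact l i).measure_lt_top, fun θ hθ => hJ θ (hK.subset l hθ),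
      fun θ hθ => hpos θ (hK.subset l hθ), fun m => ?_,
      fun m => hbdd m _ (hK.subset l) (isCompact_univ_pi (hK.isCompact l))⟩
    have hset : MeasurableSet (Set.univ.pi (K l)) :=
      MeasurableSet.univ_pi fun i => (hK.isCompact l i).measurableSet
    have := (hmeas m).indicator hset
    rwa [Set.indicator_indicator, Set.inter_eq_left.2 (hK.subset l)] at this
  have hQ : ∀ θ ∈ Set.univ.pi T, 0 < ∏ i, √|G i i (θ i)| := by
    intro θ hθ
    refine Finset.prod_pos fun i _ => Real.sqrt_pos.2 (abs_pos.2 ?_)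
    exact Finset.prod_ne_zero_iff.1 (hpos θ hθ i).ne' i (Finset.mem_univ i)
  have hprior : ∀ θ₀ ∈ Set.univ.pi T, ∀ᶠ l in atTop,
      0 < priorOn J (Set.univ.pi (K l)) θ₀ := by
    intro θ₀ hθ₀
    filter_upwards [hinfo, hK.eventually_mem hθ₀] with l hl hmem
    rw [hl.priorOn_eq_of_mem hmem]
    exact div_pos (hQ θ₀ hθ₀) (Finset.prod_pos fun i _ => hl.integral_sqrt_pos i)
  have hlim : ∀ θ₀ ∈ Set.univ.pi T, ∀ θ ∈ Set.univ.pi T,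
      Tendsto (fun l => priorOn J (Set.univ.pi (K l)) θ / priorOn J (Set.univ.pi (K l)) θ₀) atTop
        (𝓝 ((∏ i, √|G i i (θ i)|) / ∏ i, √|G i i (θ₀ i)|)) := by
    intro θ₀ hθ₀ θ hθ
    -- Once both points lie in the box, the normalizing constants cancel and the quotient is
    -- constant in `l`.
    refine tendsto_const_nhds.congr' ?_
    filter_upwards [hinfo, hK.eventually_mem hθ₀, hK.eventually_mem hθ] with l hl h₀ h₁
    rw [hl.priorOn_eq_of_mem h₀, hl.priorOn_eq_of_mem h₁, div_div_div_cancel_right₀]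
    exact (Finset.prod_pos fun i _ => hl.integral_sqrt_pos i).ne'
  constructor
  · rintro ⟨θ₀, hθ₀, -, c, hc, h⟩
    refine ⟨(c * ∏ i, √|G i i (θ₀ i)|)⁻¹, inv_pos.2 (mul_pos hc (hQ θ₀ hθ₀)), fun θ hθ => ?_⟩
    have := tendsto_nhds_unique (h θ hθ) (hlim θ₀ hθ₀ θ hθ)
    have h0 := (hQ θ₀ hθ₀).ne'
    field_simp
    rw [eq_div_iff h0] at this
    linarith
  · rintro ⟨c, hc, h⟩
    have hne : (Set.univ.pi T).Nonempty := Set.univ_pi_nonempty_iff.2 hT_ne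
    obtain ⟨θ₀, hθ₀⟩ := hne
    refine ⟨θ₀, hθ₀, hprior θ₀ hθ₀, (c * ∏ i, √|G i i (θ₀ i)|)⁻¹,
      inv_pos.2 (mul_pos hc (hQ θ₀ hθ₀)), fun θ hθ => ?_⟩
    convert hlim θ₀ hθ₀ θ hθ using 2
    rw [h θ hθ]
    have h0 := (hQ θ₀ hθ₀).ne'
    field_simp

/-! ## Wald's second identity -/

/-- Pythagoras, applied to the orthogonal family of lines spanned by the `D i`; some `D i` may be
zero. -/
theorem summable_of_pairwise_inner_eq_zero {E : Type*} [NormedAddCommGroup E]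
    [InnerProductSpace ℝ E] [CompleteSpace E] {D : ℕ → E}
    (hD : Pairwise fun i j => inner ℝ (D i) (D j) = 0) (hs : Summable fun i => ‖D i‖ ^ 2) :
    Summable D := by
  have hV : OrthogonalFamily ℝ (fun i => Submodule.span ℝ {D i})
      fun i => (Submodule.span ℝ {D i}).subtypeₗᵢ := by
    refine OrthogonalFamily.of_pairwise fun i j hij => ?_
    refine Submodule.isOrtho_span.2 ?_
    rintro u rfl v rfl
    exact hD hij
  exact (hV.summable_iff_norm_sq_summable
    fun i => ⟨D i, Submodule.mem_span_singleton_self _⟩).2 hs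

section Wald

variable {Ω 𝒳 : Type*} [MeasurableSpace Ω] [MeasurableSpace 𝒳] {P : Measure Ω} {ν : Measure 𝒳}
  {X : ℕ → Ω → 𝒳} {hX : ∀ i, Measurable (X i)} {N : Ω → ℕ∞}

theorem measurable_obsFiltration (hX : ∀ i, Measurable (X i)) {i j : ℕ} (hij : i < j) :
    Measurable[obsFiltration X hX j] (X i) := by
  rw [measurable_iff_comap_le]
  exact le_iSup₂_of_le (f := fun (i : ℕ) (_ : i < j) => MeasurableSpace.comap (X i) inferInstance)
    i hij le_rfl

/-- With indices from `0`, whether `X i` is observed is decided by the `i` observations before it,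
hence independently of `X i` itself. -/
theorem measurableSet_lt_stoppingTime (hN : IsStoppingTime (obsFiltration X hX) N) {i j : ℕ}
    (hij : i ≤ j) : MeasurableSet[obsFiltration X hX j] {ω | (i : ℕ∞) < N ω} :=
  (obsFiltration X hX).mono hij _ (hN.measurableSet_gt i)

theorem integral_mul_comp_obs (hX : ∀ i, Measurable (X i)) (hind : iIndepFun X P)
    (hlaw : ∀ i, P.map (X i) = ν) (j : ℕ) {Z : Ω → ℝ} (hZ : Measurable[obsFiltration X hX j] Z)
    {χ : 𝒳 → ℝ} (hχ : Measurable χ) :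
    ∫ ω, Z ω * χ (X j ω) ∂P = (∫ ω, Z ω ∂P) * ∫ x, χ x ∂ν := by
  have hindep : Indep (obsFiltration X hX j) (MeasurableSpace.comap (X j) inferInstance) P := by
    have := indep_iSup_of_disjoint (S := Set.Iio j) (T := {j}) (fun i => (hX i).comap_le) hind
      (by simp)
    simpa [obsFiltration] using this
  have hfun : IndepFun Z (fun ω => χ (X j ω)) P := by
    refine indep_of_indep_of_le_left (indep_of_indep_of_le_right hindep ?_) hZ.comap_le
    exact (hχ.comp (comap_measurable (X j))).comap_le
  rw [hfun.integral_fun_mul_eq_mul_integral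
    (hZ.mono ((obsFiltration X hX).le j) le_rfl).aestronglyMeasurable
    (hχ.comp (hX j)).aestronglyMeasurable, ← hlaw j,
    integral_map (hX j).aemeasurable hχ.aestronglyMeasurable]

/-- The tail sum formula: `N` is the sum of the indicators of `i < N`. -/
theorem hasSum_measureReal_lt (hN : IsStoppingTime (obsFiltration X hX) N)
    (hEN : ∫⁻ ω, (N ω : ℝ≥0∞) ∂P ≠ ⊤) :
    HasSum (fun i : ℕ => P.real {ω | (i : ℕ∞) < N ω}) (∫⁻ ω, (N ω : ℝ≥0∞) ∂P).toReal := by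
  have hmeas : ∀ i : ℕ, MeasurableSet {ω | (i : ℕ∞) < N ω} := fun i =>
    (obsFiltration X hX).le i _ (measurableSet_lt_stoppingTime hN le_rfl)
  have hpt : ∀ ω, (N ω : ℝ≥0∞) = ∑' i : ℕ, {ω | (i : ℕ∞) < N ω}.indicator 1 ω := by
    intro ω
    induction hn : N ω using ENat.recTopCoe with
    | top =>
      simp only [Set.indicator, Set.mem_ofPred_eq, hn]
      simp
    | coe n =>
      rw [tsum_eq_sum (s := Finset.range n)]
      · rw [Finset.sum_congr rfl (g := fun _ => 1)]
        · simp
        · intro i hi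
          simp [hn, Finset.mem_range.1 hi]
      · intro i hi
        have : ¬ i < n := by simpa using hi
        simp [hn, this]
  have hsum : ∫⁻ ω, (N ω : ℝ≥0∞) ∂P = ∑' i : ℕ, P {ω | (i : ℕ∞) < N ω} := by
    simp_rw [hpt]
    rw [lintegral_tsum fun i => (measurable_one.indicator (hmeas i)).aemeasurable]
    exact tsum_congr fun i => lintegral_indicator_one (hmeas i)
  rw [hsum] at hEN ⊢
  rw [ENNReal.tsum_toReal_eq fun i => ENNReal.ne_top_of_tsum_ne_top hEN i]
  exact (ENNReal.summable_toReal hEN).hasSum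

/-- The `i`-th summand of the sum of `φ (X 0), φ (X 1), …` that is stopped at `N`. -/
noncomputable def stoppedTerm (X : ℕ → Ω → 𝒳) (N : Ω → ℕ∞) (φ : 𝒳 → ℝ) (i : ℕ) : Ω → ℝ :=
  {ω | (i : ℕ∞) < N ω}.indicator fun ω => φ (X i ω)

theorem measurable_stoppedTerm (hN : IsStoppingTime (obsFiltration X hX) N) {φ : 𝒳 → ℝ}
    (hφ : Measurable φ) {i j : ℕ} (hij : i < j) :
    Measurable[obsFiltration X hX j] (stoppedTerm X N φ i) :=
  Measurable.indicator (hφ.comp (measurable_obsFiltration hX hij))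
    (measurableSet_lt_stoppingTime hN hij.le)

theorem memLp_stoppedTerm (hlaw : ∀ i, P.map (X i) = ν)
    (hN : IsStoppingTime (obsFiltration X hX) N) {φ : 𝒳 → ℝ} (hφ : MemLp φ 2 ν) (i : ℕ) :
    MemLp (stoppedTerm X N φ i) 2 P := by
  refine MemLp.indicator ((obsFiltration X hX).le i _ (measurableSet_lt_stoppingTime hN le_rfl)) ?_
  rw [← hlaw i] at hφ
  exact hφ.comp_of_map (hX i).aemeasurable

theorem integral_stoppedTerm_mul_self (hind : iIndepFun X P)
    (hlaw : ∀ i, P.map (X i) = ν) (hN : IsStoppingTime (obsFiltration X hX) N) {φ ψ : 𝒳 → ℝ}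
    (hφ : Measurable φ) (hψ : Measurable ψ) (i : ℕ) :
    ∫ ω, stoppedTerm X N φ i ω * stoppedTerm X N ψ i ω ∂P =
      P.real {ω | (i : ℕ∞) < N ω} * ∫ x, φ x * ψ x ∂ν := by
  have hset := measurableSet_lt_stoppingTime hN (le_refl i)
  have hZ : Measurable[obsFiltration X hX i] ({ω | (i : ℕ∞) < N ω}.indicator (1 : Ω → ℝ)) :=
    Measurable.indicator (@measurable_const _ _ _ (obsFiltration X hX i) (1 : ℝ)) hset
  rw [← integral_indicator_one ((obsFiltration X hX).le i _ hset),
    ← integral_mul_comp_obs hX hind hlaw i hZ (χ := fun x => φ x * ψ x) (hφ.mul hψ)]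
  refine integral_congr_ae (ae_of_all _ fun ω => ?_)
  by_cases h : (i : ℕ∞) < N ω <;> simp [stoppedTerm, h]

/-- Everything except `ψ (X j)`, including the event `j < N`, is determined by the first `j`
observations, so the centred factor splits off. -/
theorem integral_stoppedTerm_mul_of_lt (hind : iIndepFun X P)
    (hlaw : ∀ i, P.map (X i) = ν) (hN : IsStoppingTime (obsFiltration X hX) N) {φ ψ : 𝒳 → ℝ}
    (hφ : Measurable φ) (hψ : Measurable ψ) (hψ0 : ∫ x, ψ x ∂ν = 0) {i j : ℕ} (hij : i < j) :
    ∫ ω, stoppedTerm X N φ i ω * stoppedTerm X N ψ j ω ∂P = 0 := by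
  have hZ : Measurable[obsFiltration X hX j]
      ({ω | (j : ℕ∞) < N ω}.indicator (stoppedTerm X N φ i)) :=
    Measurable.indicator (measurable_stoppedTerm hN hφ hij) (measurableSet_lt_stoppingTime hN le_rfl)
  have h := integral_mul_comp_obs hX hind hlaw j hZ hψ
  rw [hψ0, mul_zero] at h
  rw [← h]
  refine integral_congr_ae (ae_of_all _ fun ω => ?_)
  by_cases h : (j : ℕ∞) < N ω <;> simp [stoppedTerm, h]

theorem integral_stoppedTerm_mul_of_ne (hind : iIndepFun X P)
    (hlaw : ∀ i, P.map (X i) = ν) (hN : IsStoppingTime (obsFiltration X hX) N) {φ ψ : 𝒳 → ℝ}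
    (hφ : Measurable φ) (hψ : Measurable ψ) (hφ0 : ∫ x, φ x ∂ν = 0) (hψ0 : ∫ x, ψ x ∂ν = 0)
    {i j : ℕ} (hij : i ≠ j) :
    ∫ ω, stoppedTerm X N φ i ω * stoppedTerm X N ψ j ω ∂P = 0 := by
  rcases lt_or_gt_of_ne hij with h | h
  · exact integral_stoppedTerm_mul_of_lt hind hlaw hN hφ hψ hψ0 h
  · simp_rw [mul_comm (stoppedTerm X N φ i _)]
    exact integral_stoppedTerm_mul_of_lt hind hlaw hN hψ hφ hφ0 h

theorem inner_toLp_two {u v : Ω → ℝ} (hu : MemLp u 2 P) (hv : MemLp v 2 P) :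
    inner ℝ (hu.toLp u) (hv.toLp v) = ∫ ω, u ω * v ω ∂P := by
  rw [L2.inner_def]
  refine integral_congr_ae ?_
  filter_upwards [hu.coeFn_toLp, hv.coeFn_toLp] with ω h1 h2
  rw [h1, h2]
  simp [mul_comm]

/-- The terms are orthogonal in `L²` with squared norms `P(i < N) * ∫ φ²`, whose sum is finite
because `E(N)` is. -/
theorem summable_toLp_stoppedTerm (hind : iIndepFun X P)
    (hlaw : ∀ i, P.map (X i) = ν) (hN : IsStoppingTime (obsFiltration X hX) N)
    (hEN : ∫⁻ ω, (N ω : ℝ≥0∞) ∂P ≠ ⊤) {φ : 𝒳 → ℝ} (hφ : Measurable φ) (hφ2 : MemLp φ 2 ν)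
    (hφ0 : ∫ x, φ x ∂ν = 0) :
    Summable fun i => (memLp_stoppedTerm hlaw hN hφ2 i).toLp (stoppedTerm X N φ i) := by
  refine summable_of_pairwise_inner_eq_zero (fun i j hij => ?_) ?_
  · simp only [inner_toLp_two]
    exact integral_stoppedTerm_mul_of_ne hind hlaw hN hφ hφ hφ0 hφ0 hij
  · simp_rw [← real_inner_self_eq_norm_sq, inner_toLp_two,
      integral_stoppedTerm_mul_self hind hlaw hN hφ hφ]
    exact (hasSum_measureReal_lt hN hEN).summable.mul_right _

/-- A subsequence of the partial sums converges almost surely to the `L²` sum, while pointwise they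
are constant from `N ω` on. -/
theorem tsum_toLp_stoppedTerm (hind : iIndepFun X P)
    (hlaw : ∀ i, P.map (X i) = ν) (hN : IsStoppingTime (obsFiltration X hX) N)
    (hfin : ∀ᵐ ω ∂P, N ω ≠ ⊤) (hEN : ∫⁻ ω, (N ω : ℝ≥0∞) ∂P ≠ ⊤) {φ : 𝒳 → ℝ}
    (hφ : Measurable φ) (hφ2 : MemLp φ 2 ν) (hφ0 : ∫ x, φ x ∂ν = 0) :
    (∑' i, (memLp_stoppedTerm hlaw hN hφ2 i).toLp (stoppedTerm X N φ i) : Lp ℝ 2 P) =ᵐ[P]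
      fun ω => ∑ i ∈ Finset.range (N ω).toNat, φ (X i ω) := by
  have hlim := (summable_toLp_stoppedTerm hind hlaw hN hEN hφ hφ2 hφ0).hasSum.tendsto_sum_nat
  obtain ⟨ns, hns, hae⟩ := (tendstoInMeasure_of_tendsto_Lp hlim).exists_seq_tendsto_ae
  have hcoe : ∀ᵐ ω ∂P, ∀ n : ℕ,
      (∑ i ∈ Finset.range n, (memLp_stoppedTerm hlaw hN hφ2 i).toLp (stoppedTerm X N φ i) :
        Lp ℝ 2 P) ω = ∑ i ∈ Finset.range n, stoppedTerm X N φ i ω := by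
    refine ae_all_iff.2 fun n => ?_
    have h1 := Lp.coeFn_finsetSum (Finset.range n)
      (fun i => (memLp_stoppedTerm hlaw hN hφ2 i).toLp (stoppedTerm X N φ i))
    have h2 : ∀ᵐ ω ∂P, ∀ i : ℕ,
        (memLp_stoppedTerm hlaw hN hφ2 i).toLp (stoppedTerm X N φ i) ω = stoppedTerm X N φ i ω :=
      ae_all_iff.2 fun i => (memLp_stoppedTerm hlaw hN hφ2 i).coeFn_toLp
    filter_upwards [h1, h2] with ω h1 h2
    rw [h1, Finset.sum_apply]
    exact Finset.sum_congr rfl fun i _ => h2 i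
  filter_upwards [hae, hcoe, hfin] with ω hω hc hf
  refine tendsto_nhds_unique hω ?_
  refine tendsto_const_nhds.congr' ?_
  filter_upwards [hns.tendsto_atTop.eventually_ge_atTop (N ω).toNat] with m hm
  rw [hc]
  lift N ω to ℕ using hf with n hn
  rw [ENat.toNat_natCast] at hm ⊢
  rw [← Finset.sum_subset (Finset.range_mono hm)]
  · refine Finset.sum_congr rfl fun i hi => ?_
    simp [stoppedTerm, ← hn, Finset.mem_range.1 hi]
  · intro i _ hi
    have : ¬ i < n := by simpa using hi
    simp [stoppedTerm, ← hn, this]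

/-- By continuity of the inner product it suffices to treat partial sums, where orthogonality leaves
only the diagonal terms. -/
theorem integral_stoppedSum_mul_of_measurable (hind : iIndepFun X P)
    (hlaw : ∀ i, P.map (X i) = ν) (hN : IsStoppingTime (obsFiltration X hX) N)
    (hfin : ∀ᵐ ω ∂P, N ω ≠ ⊤) (hEN : ∫⁻ ω, (N ω : ℝ≥0∞) ∂P ≠ ⊤) {φ ψ : 𝒳 → ℝ}
    (hφ : Measurable φ) (hψ : Measurable ψ) (hφ2 : MemLp φ 2 ν) (hψ2 : MemLp ψ 2 ν)
    (hφ0 : ∫ x, φ x ∂ν = 0) (hψ0 : ∫ x, ψ x ∂ν = 0) :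
    ∫ ω, (∑ i ∈ Finset.range (N ω).toNat, φ (X i ω)) *
      ∑ i ∈ Finset.range (N ω).toNat, ψ (X i ω) ∂P =
      (∫⁻ ω, (N ω : ℝ≥0∞) ∂P).toReal * ∫ x, φ x * ψ x ∂ν := by
  have hsφ := summable_toLp_stoppedTerm hind hlaw hN hEN hφ hφ2 hφ0
  have hsψ := summable_toLp_stoppedTerm hind hlaw hN hEN hψ hψ2 hψ0
  have hlim := hsφ.hasSum.tendsto_sum_nat.inner (𝕜 := ℝ) hsψ.hasSum.tendsto_sum_nat
  have hlim' := ((hasSum_measureReal_lt hN hEN).mul_right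
    (∫ x, φ x * ψ x ∂ν)).tendsto_sum_nat
  refine Eq.trans ?_ (tendsto_nhds_unique hlim (hlim'.congr fun n => ?_))
  · rw [L2.inner_def]
    refine integral_congr_ae ?_
    filter_upwards [tsum_toLp_stoppedTerm hind hlaw hN hfin hEN hφ hφ2 hφ0,
      tsum_toLp_stoppedTerm hind hlaw hN hfin hEN hψ hψ2 hψ0] with ω h1 h2
    rw [h1, h2]
    simp [mul_comm]
  · rw [sum_inner]
    refine Finset.sum_congr rfl fun i hi => ?_
    rw [inner_sum, Finset.sum_eq_single_of_mem i hi, inner_toLp_two,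
      integral_stoppedTerm_mul_self hind hlaw hN hφ hψ]
    intro j _ hj
    rw [inner_toLp_two, integral_stoppedTerm_mul_of_ne hind hlaw hN hφ hψ hφ0 hψ0 hj.symm]

/-- **Wald's second identity** for two centred square integrable functions of the observations. -/
theorem integral_stoppedSum_mul (hind : iIndepFun X P)
    (hlaw : ∀ i, P.map (X i) = ν) (hN : IsStoppingTime (obsFiltration X hX) N)
    (hfin : ∀ᵐ ω ∂P, N ω ≠ ⊤) (hEN : ∫⁻ ω, (N ω : ℝ≥0∞) ∂P ≠ ⊤) {φ ψ : 𝒳 → ℝ}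
    (hφ2 : MemLp φ 2 ν) (hψ2 : MemLp ψ 2 ν)
    (hφ0 : ∫ x, φ x ∂ν = 0) (hψ0 : ∫ x, ψ x ∂ν = 0) :
    ∫ ω, (∑ i ∈ Finset.range (N ω).toNat, φ (X i ω)) *
      ∑ i ∈ Finset.range (N ω).toNat, ψ (X i ω) ∂P =
      (∫⁻ ω, (N ω : ℝ≥0∞) ∂P).toReal * ∫ x, φ x * ψ x ∂ν := by
  -- The independence argument needs measurable functions, and `MemLp` provides them up to null
  -- sets, which countably many observations of law `ν` almost surely avoid.
  set φ' := hφ2.aestronglyMeasurable.mk φ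
  set ψ' := hψ2.aestronglyMeasurable.mk ψ
  have eφ : φ =ᵐ[ν] φ' := hφ2.aestronglyMeasurable.ae_eq_mk
  have eψ : ψ =ᵐ[ν] ψ' := hψ2.aestronglyMeasurable.ae_eq_mk
  have key := integral_stoppedSum_mul_of_measurable hind hlaw hN hfin hEN
    hφ2.aestronglyMeasurable.stronglyMeasurable_mk.measurable
    hψ2.aestronglyMeasurable.stronglyMeasurable_mk.measurable
    ((memLp_congr_ae eφ).1 hφ2) ((memLp_congr_ae eψ).1 hψ2)
    ((integral_congr_ae eφ).symm.trans hφ0) ((integral_congr_ae eψ).symm.trans hψ0)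
  have hpull : ∀ {u v : 𝒳 → ℝ}, u =ᵐ[ν] v → ∀ᵐ ω ∂P, ∀ i, u (X i ω) = v (X i ω) := by
    intro u v huv
    refine ae_all_iff.2 fun i => ?_
    rw [← hlaw i] at huv
    exact ae_of_ae_map (hX i).aemeasurable huv
  rw [integral_congr_ae (f := fun x => φ x * ψ x) (g := fun x => φ' x * ψ' x) (eφ.mul eψ), ← key]
  refine integral_congr_ae ?_
  filter_upwards [hpull eφ, hpull eψ] with ω h1 h2
  simp only [h1, h2]
  rfl

end Wald

/-! ## The Fisher information of the sequential experiment -/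

theorem measurable_indicator_of_restrict {α : Type*} [MeasurableSpace α] {s : Set α}
    (hs : MeasurableSet s) {u : α → ℝ} (hu : Measurable (s.domRestrict u)) :
    Measurable (s.indicator u) := by
  refine measurable_of_restrict_of_restrict_compl hs ?_ ?_
  · convert hu using 1
    funext x
    exact Set.indicator_of_mem x.2 u
  · convert measurable_const (a := (0 : ℝ)) using 1
    funext x
    exact Set.indicator_of_notMem x.2 u

section Info

variable {k : ℕ} {Ω 𝒳 : Type*} [MeasurableSpace Ω] [MeasurableSpace 𝒳] {μ : Measure 𝒳}
  {Θ : Set (Fin k → ℝ)} {f : (Fin k → ℝ) → 𝒳 → ℝ}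

theorem IsRegularFamily.nonneg (hf : IsRegularFamily μ Θ f) {θ : Fin k → ℝ} (hθ : θ ∈ Θ) (x : 𝒳) :
    0 ≤ f θ x := by
  rcases hf.common_support x with h | h
  · exact (h θ hθ).le
  · exact (h θ hθ).ge

theorem IsRegularFamily.differentiableAt (hf : IsRegularFamily μ Θ f) (hΘ : IsOpen Θ)
    {θ : Fin k → ℝ} (hθ : θ ∈ Θ) (x : 𝒳) : DifferentiableAt ℝ (fun θ' => f θ' x) θ :=
  (hf.differentiable x).differentiableAt (hΘ.mem_nhds hθ)

theorem IsRegularFamily.integral_eq_one (hf : IsRegularFamily μ Θ f) {θ : Fin k → ℝ}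
    (hθ : θ ∈ Θ) : ∫ x, f θ x ∂μ = 1 := by
  rw [integral_eq_lintegral_of_nonneg_ae (ae_of_all _ (hf.nonneg hθ))
    (hf.measurable θ hθ).aestronglyMeasurable]
  have := (hf.isProbability θ hθ).measure_univ
  rw [obsLaw, withDensity_apply _ MeasurableSet.univ, Measure.restrict_univ] at this
  rw [this, ENNReal.toReal_one]

/-- Where the density is zero it is zero for all parameters nearby, so the derivative vanishes too.
-/
theorem IsRegularFamily.mul_score (hf : IsRegularFamily μ Θ f) (hΘ : IsOpen Θ)
    {θ : Fin k → ℝ} (hθ : θ ∈ Θ) (a : Fin k) (x : 𝒳) :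
    f θ x * score f θ a x = lineDeriv ℝ (fun θ' => f θ' x) θ (Pi.single a 1) := by
  rcases hf.common_support x with h | h
  · have hd := hf.differentiableAt hΘ hθ x
    have hne : f θ x ≠ 0 := (h θ hθ).ne'
    rw [score, (hd.log hne).lineDeriv_eq_fderiv, hd.lineDeriv_eq_fderiv, fderiv.log hd hne]
    simp [hne]
  · have : (fun θ' => f θ' x) =ᶠ[𝓝 θ] fun _ => 0 := by
      filter_upwards [hΘ.mem_nhds hθ] with θ' hθ' using h θ' hθ'
    rw [this.lineDeriv_eq, h θ hθ]
    simp [lineDeriv]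

theorem IsRegularFamily.integral_score (hf : IsRegularFamily μ Θ f) (hΘ : IsOpen Θ)
    {θ : Fin k → ℝ} (hθ : θ ∈ Θ) (a : Fin k) : ∫ x, score f θ a x ∂(obsLaw μ f θ) = 0 := by
  have hconst : (fun θ' => ∫ x, f θ' x ∂μ) =ᶠ[𝓝 θ] fun _ => 1 := by
    filter_upwards [hΘ.mem_nhds hθ] with θ' hθ' using hf.integral_eq_one hθ'
  rw [obsLaw, integral_withDensity_eq_integral_toReal_smul
    (hf.measurable θ hθ).ennreal_ofReal (ae_of_all _ fun _ => ENNReal.ofReal_lt_top)]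
  calc ∫ x, (ENNReal.ofReal (f θ x)).toReal • score f θ a x ∂μ
      = ∫ x, lineDeriv ℝ (fun θ' => f θ' x) θ (Pi.single a 1) ∂μ := by
        congr 1
        funext x
        rw [ENNReal.toReal_ofReal (hf.nonneg hθ x), smul_eq_mul, hf.mul_score hΘ hθ]
    _ = 0 := by
        rw [hf.integral_deriv θ hθ a, hconst.lineDeriv_eq]
        simp [lineDeriv]

theorem IsRegularFamily.ae_pos (hf : IsRegularFamily μ Θ f) {θ : Fin k → ℝ} (hθ : θ ∈ Θ) :
    ∀ᵐ x ∂(obsLaw μ f θ), 0 < f θ x := by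
  rw [obsLaw, ae_withDensity_iff (hf.measurable θ hθ).ennreal_ofReal]
  refine ae_of_all _ fun x hx => ?_
  by_contra h
  exact hx (ENNReal.ofReal_eq_zero.2 (not_lt.1 h))

theorem IsRegularFamily.score_stoppedLikelihood {Ω : Type*}
    (hf : IsRegularFamily μ Θ f)
    (hΘ : IsOpen Θ) {X : ℕ → Ω → 𝒳} {N : Ω → ℕ∞} {θ : Fin k → ℝ} (hθ : θ ∈ Θ) (a : Fin k) {ω : Ω}
    (hω : ∀ i, 0 < f θ (X i ω)) :
    score (stoppedLikelihood f X N) θ a ω =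
      ∑ i ∈ Finset.range (N ω).toNat, score f θ a (X i ω) := by
  -- Positivity is needed at all parameters near `θ` for the logarithm of the product to split
  -- there; the common support transfers it from `θ`.
  have hpos : ∀ θ' ∈ Θ, ∀ i, 0 < f θ' (X i ω) := by
    intro θ' hθ' i
    rcases hf.common_support (X i ω) with h | h
    · exact h θ' hθ'
    · exact absurd (h θ hθ) (hω i).ne'
  have hd : ∀ i, DifferentiableAt ℝ (fun θ' => Real.log (f θ' (X i ω))) θ := fun i =>
    (hf.differentiableAt hΘ hθ _).log (hω i).ne'
  have hev : (fun θ' => Real.log (stoppedLikelihood f X N θ' ω)) =ᶠ[𝓝 θ] fun θ' =>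
      ∑ i ∈ Finset.range (N ω).toNat, Real.log (f θ' (X i ω)) := by
    filter_upwards [hΘ.mem_nhds hθ] with θ' hθ'
    exact Real.log_prod fun i _ => (hpos θ' hθ' i).ne'
  rw [score, hev.lineDeriv_eq,
    (DifferentiableAt.fun_sum fun i _ => hd i).lineDeriv_eq_fderiv, fderiv_fun_sum fun i _ => hd i,
    sum_apply]
  exact Finset.sum_congr rfl fun i _ => ((hd i).lineDeriv_eq_fderiv).symm

theorem IsIIDSample.isProbabilityMeasure {P : (Fin k → ℝ) → Measure Ω} {X : ℕ → Ω → 𝒳}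
    (hiid : IsIIDSample μ Θ f P X) (hf : IsRegularFamily μ Θ f) (hX : ∀ i, Measurable (X i))
    {θ : Fin k → ℝ} (hθ : θ ∈ Θ) : IsProbabilityMeasure (P θ) := by
  refine ⟨?_⟩
  rw [← (hf.isProbability θ hθ).measure_univ, ← hiid.law θ hθ 0,
    Measure.map_apply (hX 0) MeasurableSet.univ, Set.preimage_univ]

theorem sequentialInfo_eq (hf : IsRegularFamily μ Θ f) (hΘ : IsOpen Θ)
    {P : (Fin k → ℝ) → Measure Ω} {X : ℕ → Ω → 𝒳} {hX : ∀ i, Measurable (X i)}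
    (hiid : IsIIDSample μ Θ f P X) {N : Ω → ℕ∞} (hN : IsProperStoppingTime Θ P X hX N)
    {θ : Fin k → ℝ} (hθ : θ ∈ Θ) (hEN : expectedN P N θ ≠ ⊤) :
    sequentialInfo f P X N θ = (expectedN P N θ).toReal • obsInfo μ f θ := by
  ext a b
  have hscore : ∀ᵐ ω ∂(P θ), ∀ i, 0 < f θ (X i ω) := by
    refine ae_all_iff.2 fun i => ?_
    have := hf.ae_pos hθ
    rw [← hiid.law θ hθ i] at this
    exact ae_of_ae_map (hX i).aemeasurable this
  simp only [sequentialInfo, obsInfo, fisherInfo, Matrix.of_apply, Matrix.smul_apply, smul_eq_mul]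
  rw [expectedN, ← integral_stoppedSum_mul (hX := hX) (hiid.indep θ hθ) (hiid.law θ hθ)
    hN.isStoppingTime (hN.finite θ hθ) hEN (hf.score_memLp θ hθ a) (hf.score_memLp θ hθ b)
    (hf.integral_score hΘ hθ a) (hf.integral_score hΘ hθ b)]
  refine integral_congr_ae ?_
  filter_upwards [hscore] with ω hω
  rw [hf.score_stoppedLikelihood hΘ hθ a hω, hf.score_stoppedLikelihood hΘ hθ b hω]

theorem one_le_expectedN (hf : IsRegularFamily μ Θ f)
    {P : (Fin k → ℝ) → Measure Ω} {X : ℕ → Ω → 𝒳} {hX : ∀ i, Measurable (X i)}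
    (hiid : IsIIDSample μ Θ f P X) {N : Ω → ℕ∞} (hN : IsProperStoppingTime Θ P X hX N)
    {θ : Fin k → ℝ} (hθ : θ ∈ Θ) : 1 ≤ expectedN P N θ := by
  have := hiid.isProbabilityMeasure hf hX hθ
  calc (1 : ℝ≥0∞) = ∫⁻ _, 1 ∂(P θ) := by simp
    _ ≤ expectedN P N θ := lintegral_mono fun ω => by
        have h := hN.one_le ω
        simpa using ENat.toENNReal_mono h

end Info

end SequentialPrior

/-! ### The corollary: comparison of the two experiments -/

theorem corollary2p1 {k : ℕ} {Ω 𝒳 : Type*} [MeasurableSpace Ω] [MeasurableSpace 𝒳]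
    (μ : Measure 𝒳) (f : (Fin k → ℝ) → 𝒳 → ℝ)
    -- the parameter space is the product of the ranges `T i` of the single parameters
    (T : Fin k → Set ℝ) (hT_open : ∀ i, IsOpen (T i)) (hT_ne : ∀ i, (T i).Nonempty)
    (hf : IsRegularFamily μ (Set.univ.pi T) f)
    -- the i.i.d. observations and the stopping time
    (P : (Fin k → ℝ) → Measure Ω) (X : ℕ → Ω → 𝒳) (hX : ∀ i, Measurable (X i))
    (hiid : IsIIDSample μ (Set.univ.pi T) f P X)
    (N : Ω → ℕ∞) (hN : IsProperStoppingTime (Set.univ.pi T) P X hX N)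
    -- the product form of the Fisher information matrix of one observation
    (G : Fin k → Fin k → ℝ → ℝ)
    (hG : ∀ θ ∈ Set.univ.pi T,
      obsInfo μ f θ = Matrix.diagonal fun l => ∏ i, G l i (θ i))
    -- the product form of the expected stopping time
    (g : Fin k → ℝ → ℝ)
    (hg : ∀ θ ∈ Set.univ.pi T, expectedN P N θ = ENNReal.ofReal (∏ i, g i (θ i)))
    -- the expected stopping time is measurable and locally bounded in the parameter
    (hEN_meas : Measurable fun θ : Set.univ.pi T => expectedN P N θ)
    (hEN_bdd : ∀ C ⊆ Set.univ.pi T, IsCompact C →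
      BddAbove ((fun θ => (expectedN P N θ).toReal) '' C))
    -- the compact boxes of the reference prior algorithm
    (K : ℕ → Fin k → Set ℝ) (hK : IsCompactExhaustion T K) :
    IsReferencePrior (Set.univ.pi T) (obsInfo μ f) (fun l => Set.univ.pi (K l))
        (fun θ => ∏ i, √|G i i (θ i)|) ∧
      ∀ πR : (Fin k → ℝ) → ℝ,
        IsReferencePrior (Set.univ.pi T) (obsInfo μ f) (fun l => Set.univ.pi (K l)) πR →
        ∀ πS : (Fin k → ℝ) → ℝ,
          IsReferencePrior (Set.univ.pi T) (sequentialInfo f P X N)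
              (fun l => Set.univ.pi (K l)) πS ↔
            ProportionalOn (Set.univ.pi T) πS
              (fun θ => √((expectedN P N θ).toReal) * πR θ) := by

  have hΘ : IsOpen (Set.univ.pi T) := isOpen_set_pi Set.finite_univ fun i _ => hT_open i
  have hpos : ∀ θ ∈ Set.univ.pi T, ∀ l, 0 < ∏ i, G l i (θ i) := by
    intro θ hθ
    have := hf.info_posDef θ hθ
    rw [hG θ hθ] at this
    exact Matrix.posDef_diagonal_iff.1 this
  have hcont : ∀ l, ContinuousOn (fun θ : Fin k → ℝ => ∏ i, G l i (θ i)) (Set.univ.pi T) := by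
    intro l
    refine ContinuousOn.congr (f := fun θ => obsInfo μ f θ l l) ?_ fun θ hθ => ?_
    · exact ((continuous_apply_apply l l).comp_continuousOn hf.info_continuous :)
    · simp only [hG θ hθ, Matrix.diagonal_apply_eq]
  have hmeas : ∀ l, Measurable ((Set.univ.pi T).indicator
      fun θ : Fin k → ℝ => ∏ i, G l i (θ i)) := fun l =>
    measurable_indicator_of_restrict hΘ.measurableSet
      (continuousOn_iff_continuous_domRestrict.1 (hcont l)).measurable
  have hbdd : ∀ l, ∀ C ⊆ Set.univ.pi T, IsCompact C →
      ∃ M, ∀ θ ∈ C, |Real.log (∏ i, G l i (θ i))| ≤ M := by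
    intro l C hC hCc
    exact hCc.exists_bound_of_continuousOn
      (((hcont l).mono hC).log fun θ hθ => (hpos θ (hC hθ) l).ne')
  have hENtop : ∀ θ ∈ Set.univ.pi T, expectedN P N θ ≠ ⊤ := fun θ hθ =>
    hg θ hθ ▸ ENNReal.ofReal_ne_top
  -- The lower bound from `N ≥ 1` keeps `E(N)` away from zero, so that `log E(N)` is bounded on
  -- compact sets.
  have hENone : ∀ θ ∈ Set.univ.pi T, 1 ≤ (expectedN P N θ).toReal := fun θ hθ =>
    (ENNReal.toReal_mono (hENtop θ hθ) (one_le_expectedN hf hiid hN hθ)).trans_eq' ENNReal.toReal_one.symm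
  have hENprod : ∀ θ ∈ Set.univ.pi T, (expectedN P N θ).toReal = ∏ i, g i (θ i) := by
    intro θ hθ
    have h1 := hENone θ hθ
    rw [hg θ hθ, ENNReal.toReal_ofReal']  at h1 ⊢
    -- `ENNReal.ofReal` truncates at zero; a nonpositive product would contradict `E(N) ≥ 1`.
    rcases le_total (∏ i, g i (θ i)) 0 with h | h
    · rw [max_eq_right h] at h1
      norm_num at h1
    · exact max_eq_left h
  have hprod : ∀ θ ∈ Set.univ.pi T, ∀ l, ∏ i, g i (θ i) * G l i (θ i) =
      (expectedN P N θ).toReal * ∏ i, G l i (θ i) := by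
    intro θ hθ l
    rw [Finset.prod_mul_distrib, hENprod θ hθ]
  have hobs := isReferencePrior_iff hT_open hT_ne hK hG hpos hmeas hbdd
  have hseq := isReferencePrior_iff hT_open hT_ne hK (J := sequentialInfo f P X N)
    (G := fun l i t => g i t * G l i t)
    (fun θ hθ => by
      rw [sequentialInfo_eq hf hΘ hiid hN hθ (hENtop θ hθ), hG θ hθ, ← Matrix.diagonal_smul]
      congr 1
      funext l
      rw [hprod θ hθ]
      rfl)
    (fun θ hθ l => by
      rw [hprod θ hθ]
      exact mul_pos (zero_lt_one.trans_le (hENone θ hθ)) (hpos θ hθ l))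
    (fun l => by
      refine measurable_indicator_of_restrict hΘ.measurableSet ?_
      convert hEN_meas.ennreal_toReal.mul
        (continuousOn_iff_continuous_domRestrict.1 (hcont l)).measurable using 1
      funext θ
      exact hprod θ θ.2 l)
    (fun l C hC hCc => by
      obtain ⟨M, hM⟩ := hbdd l C hC hCc
      obtain ⟨M', hM'⟩ := hEN_bdd C hC hCc
      refine ⟨Real.log M' + M, fun θ hθ => ?_⟩
      have h1 := hENone θ (hC hθ)
      rw [hprod θ (hC hθ), Real.log_mul (zero_lt_one.trans_le h1).ne' (hpos θ (hC hθ) l).ne']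
      refine (abs_add_le _ _).trans (add_le_add ?_ (hM θ hθ))
      rw [abs_of_nonneg (Real.log_nonneg h1)]
      exact Real.log_le_log (zero_lt_one.trans_le h1) (hM' ⟨θ, hθ, rfl⟩))
  refine ⟨(hobs _).2 ⟨1, one_pos, fun θ _ => (one_mul _).symm⟩, fun πR hR πS => ?_⟩
  obtain ⟨c, hc, hcR⟩ := (hobs πR).1 hR
  have hsqrt : ∀ θ ∈ Set.univ.pi T, ∏ i, √|g i (θ i) * G i i (θ i)| =
      √((expectedN P N θ).toReal) * ∏ i, √|G i i (θ i)| := by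
    intro θ hθ
    -- The absolute value is put around the whole product first, since the root distributes only
    -- over the nonnegative factors `|g i|`.
    rw [hENprod θ hθ, ← abs_of_nonneg (zero_le_one.trans ((hENone θ hθ).trans_eq (hENprod θ hθ))),
      Finset.abs_prod, Real.sqrt_prod _ fun i _ => abs_nonneg _, ← Finset.prod_mul_distrib]
    exact Finset.prod_congr rfl fun i _ => by rw [abs_mul, Real.sqrt_mul (abs_nonneg _)]
  rw [hseq]
  constructor
  · rintro ⟨d, hd, h⟩
    refine ⟨d / c, div_pos hd hc, fun θ hθ => ?_⟩
    simp only [h θ hθ, hcR θ hθ, hsqrt θ hθ]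
    field_simp
  · rintro ⟨d, hd, h⟩
    refine ⟨d * c, mul_pos hd hc, fun θ hθ => ?_⟩
    simp only [h θ hθ, hcR θ hθ, hsqrt θ hθ]
    ring
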